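/- Let $n\ge 1$ and let $\delta:[0,\infty)\to\mathbb{R}$ be a $C^1$ non-increasing function with $\delta'(0)=0$. Consider $\mathbb{R}^{n+1}$ with the radial weight $e^{\psi}$, where $\psi(x):=\delta(|x|)$. Let $\Sigma$ be a smooth, connected, two-sided (immersed) hypersurface in $\mathbb{R}^{n+1}$, possibly with smooth boundary $\partial\Sigma$, with smooth unit normal $N$ and the induced metric. For a vector field $X$ of $\mathbb{R}^{n+1}$ along $\Sigma$ put $\operatorname{div}_{\Sigma,\psi}X:=\operatorname{div}_\Sigma X+\langle\nabla\psi,X\rangle$, and for $u\in C^2(\Sigma)$ put $\Delta_{\Sigma,\psi}u:=\operatorname{div}_{\Sigma,\psi}(\nabla_\Sigma u)$. Let $\nu$ denote the inner unit conormal of $\Sigma$ along $\partial\Sigma$ (the unit vector tangent to $\Sigma$, normal to $\partial\Sigma$ and pointing into $\Sigma$). Suppose that * $\Sigma$ is $\psi$-minimal, i.e. $H_\psi:=-\operatorname{div}_{\Sigma,\psi}N=0$ on $\Sigma$; * $\Sigma$ is $\psi$-parabolic, i.e. every $u\in C^2(\Sigma)$ that is bounded from above and satisfies $\Delta_{\Sigma,\psi}u\ge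 0$ on $\Sigma\setminus\partial\Sigma$ and $\partial u/\partial\nu\ge 0$ along $\partial\Sigma$ is constant; * $\Sigma\subseteq F$ for a closed half-space $F\subset\mathbb{R}^{n+1}$ with $0\in\partial F$, and $\langle\eta,\nu\rangle\ge 0$ along $\partial\Sigma$, where $\eta$ is the unit normal to $\partial F$ pointing outside $F$. Then $\Sigma$ is contained in a hyperplane parallel to $\partial F$. Moreover, if $\psi$ is non-constant on $\Sigma$, then $\Sigma\subseteq\partial F$. -/

import Mathlib

open scoped Manifold ContDiff InnerProductSpace

noncomputable section

namespace WeightedHypersurface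

/-- The Euclidean space `ℝⁿ⁺¹`. -/
abbrev Amb (n : ℕ) : Type := EuclideanSpace ℝ (Fin (n + 1))

/-- The closed half-space `{x | ⟨x, η⟩ ≤ c}`; if `η` is a unit vector then `η` is the unit normal to
its boundary that points outside it. -/
def closedHalfSpace {n : ℕ} (η : Amb n) (c : ℝ) : Set (Amb n) := {x | ⟪x, η⟫_ℝ ≤ c}

/-- The hyperplane `{x | ⟨x, η⟩ = a}`. -/
def hyperplane {n : ℕ} (η : Amb n) (a : ℝ) : Set (Amb n) := {x | ⟪x, η⟫_ℝ = a}

/-- The radial function `ψ(x) = δ(|x|)`. -/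
def radial {n : ℕ} (δ : ℝ → ℝ) (x : Amb n) : ℝ := δ ‖x‖

/-! A hypersurface (possibly with boundary) is an `n`-manifold `M` modelled on the closed half-space
of `ℝⁿ`, with a smooth immersion `f : M → ℝⁿ⁺¹`, which is the inclusion map in the embedded case.
The metric of `M` is the one induced by `f`. Vectors tangent to the hypersurface at `p` are the
elements of the range of the differential of `f` at `p`. -/

variable {n : ℕ} [NeZero n] {M : Type*} [TopologicalSpace M]
  [ChartedSpace (EuclideanHalfSpace n) M]

/-- The derivative at `p` of a vector-valued function on `M` in the direction of a tangent vector `v`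
of `M` at `p`, which is read in the preferred chart at `p`. -/
def dirDeriv {F : Type*} [NormedAddCommGroup F] [NormedSpace ℝ F]
    (X : M → F) (p : M) (v : EuclideanSpace ℝ (Fin n)) : F :=
  mfderiv (𝓡∂ n) 𝓘(ℝ, F) X p v

/-- The derivative in the direction of the `i`-th coordinate vector of the preferred chart. -/
def partialDeriv {F : Type*} [NormedAddCommGroup F] [NormedSpace ℝ F]
    (X : M → F) (p : M) (i : Fin n) : F :=
  dirDeriv X p (EuclideanSpace.single i (1 : ℝ))

/-- `f` is a smooth immersion of `M` in `ℝⁿ⁺¹`. -/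
structure IsHypersurface (f : M → Amb n) : Prop where
  smooth : ContMDiff (𝓡∂ n) 𝓘(ℝ, Amb n) ∞ f
  injective_dirDeriv : ∀ p : M,
    Function.Injective fun v : EuclideanSpace ℝ (Fin n) => dirDeriv f p v

/-- `N` is a Gauss map: a globally defined smooth unit normal along `f`. -/
structure IsGaussMap (f N : M → Amb n) : Prop where
  smooth : ContMDiff (𝓡∂ n) 𝓘(ℝ, Amb n) ∞ N
  norm_eq_one : ∀ p : M, ‖N p‖ = 1
  normal : ∀ (p : M) (v : EuclideanSpace ℝ (Fin n)), ⟪dirDeriv f p v, N p⟫_ℝ = 0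

/-- The matrix `g_{ij} = ⟨∂ᵢ f, ∂ⱼ f⟩` of the induced metric at `p`. -/
def gram (f : M → Amb n) (p : M) : Matrix (Fin n) (Fin n) ℝ :=
  Matrix.of fun i j => ⟪partialDeriv f p i, partialDeriv f p j⟫_ℝ

/-- The gradient `∇_Σ u = ∑ gⁱʲ (∂ⱼ u) ∂ᵢ f`, as a vector field of `ℝⁿ⁺¹` along the hypersurface. -/
def surfGrad (f : M → Amb n) (u : M → ℝ) (p : M) : Amb n :=
  ∑ i, ∑ j, ((gram f p)⁻¹ i j * partialDeriv u p j) • partialDeriv f p i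

/-- The divergence `div_Σ X = ∑ gⁱʲ ⟨∂ᵢ X, ∂ⱼ f⟩` of a vector field `X` of `ℝⁿ⁺¹` along the
hypersurface, not necessarily tangent to it: the trace over the tangent space of `v ↦ D_v X`. -/
def surfDiv (f X : M → Amb n) (p : M) : ℝ :=
  ∑ i, ∑ j, (gram f p)⁻¹ i j * ⟪partialDeriv X p i, partialDeriv f p j⟫_ℝ

/-- The `ψ`-divergence `div_{Σ,ψ} X = div_Σ X + ⟨∇ψ, X⟩`. -/
def weightedDiv (ψ : Amb n → ℝ) (f X : M → Amb n) (p : M) : ℝ :=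
  surfDiv f X p + ⟪gradient ψ (f p), X p⟫_ℝ

/-- The `ψ`-Laplacian `Δ_{Σ,ψ} u = div_{Σ,ψ} (∇_Σ u)`. -/
def weightedLaplacian (ψ : Amb n → ℝ) (f : M → Amb n) (u : M → ℝ) (p : M) : ℝ :=
  weightedDiv ψ f (surfGrad f u) p

/-- The `ψ`-mean curvature `H_ψ = -div_{Σ,ψ} N`. -/
def weightedMeanCurvature (ψ : Amb n → ℝ) (f N : M → Amb n) (p : M) : ℝ :=
  -weightedDiv ψ f N p

/-- `ψ`-minimality. -/
def IsWeightedMinimal (ψ : Amb n → ℝ) (f N : M → Amb n) : Prop :=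
  ∀ p : M, weightedMeanCurvature ψ f N p = 0

/-- `ν` is the inner unit conormal at the boundary point `p`: the unit vector tangent to the
hypersurface, orthogonal to its boundary, and pointing into it. The preferred chart at `p` takes values
in `{x | 0 ≤ x 0}`, so the tangent vectors of `M` at `p` that are tangent to the boundary are those with
vanishing `0`-th coordinate, and those that point inwards have a positive one. -/
def IsInnerConormal (f : M → Amb n) (p : M) (ν : Amb n) : Prop :=
  ‖ν‖ = 1 ∧
  (∃ v : EuclideanSpace ℝ (Fin n), 0 < v 0 ∧ dirDeriv f p v = ν) ∧
  ∀ w : EuclideanSpace ℝ (Fin n), w 0 = 0 → ⟪dirDeriv f p w, ν⟫_ℝ = 0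

/-- `ψ`-parabolicity: every `C²` function on the hypersurface that is bounded from above,
`ψ`-subharmonic away from the boundary and with `∂u/∂ν = ⟨∇_Σ u, ν⟩ ≥ 0` along the boundary is
constant. -/
def IsWeightedParabolic (ψ : Amb n → ℝ) (f : M → Amb n) : Prop :=
  ∀ u : M → ℝ, ContMDiff (𝓡∂ n) 𝓘(ℝ, ℝ) 2 u → BddAbove (Set.range u) →
    (∀ p ∈ (𝓡∂ n).interior M, 0 ≤ weightedLaplacian ψ f u p) →
    (∀ p ∈ (𝓡∂ n).boundary M, ∀ ν : Amb n, IsInnerConormal f p ν → 0 ≤ ⟪surfGrad f u p, ν⟫_ℝ) →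
    ∃ a : ℝ, ∀ p : M, u p = a

end WeightedHypersurface

end

/-!
The argument applies parabolicity to the height `u = ⟨f, η⟩`. Its gradient is the tangential part
`η - ⟨N, η⟩ N` of `η`, so the Leibniz rule for the `ψ`-divergence gives
`Δ_{Σ,ψ} u = ⟨∇ψ, η⟩ + ⟨N, η⟩ H_ψ`, which is `⟨∇ψ, η⟩` on a `ψ`-minimal hypersurface. A
non-increasing radial weight has `∇ψ(x) = (δ'(|x|) / |x|) x`, whence `⟨∇ψ, η⟩ ≥ 0` where
`⟨x, η⟩ ≤ 0`; so `u` is constant, `u = a`. If `a ≠ 0` then `0 = Δ_{Σ,ψ} u = (δ'(|f|) / |f|) a` forces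
`δ' = 0` on the interval of all values of `|f|`, and `ψ` is constant on `Σ`.
-/

namespace WeightedHypersurface

section Calculus

variable {E : Type*} [NormedAddCommGroup E] [InnerProductSpace ℝ E]

theorem frontier_inner_le [CompleteSpace E] {η : E} (hη : η ≠ 0) (c : ℝ) :
    frontier {x | ⟪x, η⟫_ℝ ≤ c} = {x | ⟪x, η⟫_ℝ = c} := by
  have hsurj : Function.Surjective (innerSL ℝ η) := fun t =>
    ⟨(t / ‖η‖ ^ 2) • η, by simp [hη]⟩
  simpa [Set.preimage, real_inner_comm] using
    (innerSL ℝ η).frontier_preimage hsurj (Set.Iic c)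

theorem hasFDerivAt_norm {x : E} (hx : x ≠ 0) :
    HasFDerivAt (fun y : E => ‖y‖) (‖x‖⁻¹ • innerSL ℝ x) x := by
  have hsqrt := (hasStrictFDerivAt_norm_sq x).hasFDerivAt.sqrt (by positivity)
  simp only [Real.sqrt_sq (norm_nonneg _)] at hsqrt
  convert hsqrt using 1
  module

theorem hasGradientAt_comp_norm [CompleteSpace E] {φ : ℝ → ℝ} {φ' : ℝ} {x : E} (hx : x ≠ 0)
    (hφ : HasDerivAt φ φ' ‖x‖) : HasGradientAt (fun y => φ ‖y‖) ((φ' / ‖x‖) • x) x := by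
  rw [hasGradientAt_iff_hasFDerivAt]
  refine (hφ.comp_hasFDerivAt x (hasFDerivAt_norm hx)).congr_fderiv ?_
  rw [smul_smul, ← div_eq_mul_inv, map_smul]
  rfl

theorem hasGradientAt_comp_norm_zero [CompleteSpace E] {φ : ℝ → ℝ}
    (hφ : HasDerivWithinAt φ 0 (Set.Ici 0) 0) : HasGradientAt (fun y : E => φ ‖y‖) 0 0 := by
  have hnorm : Filter.Tendsto (fun y : E => ‖y‖) (nhds 0) (nhdsWithin 0 (Set.Ici 0)) :=
    tendsto_nhdsWithin_iff.2 ⟨tendsto_norm_zero, .of_forall norm_nonneg⟩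
  have ho := (hasDerivWithinAt_iff_isLittleO.1 hφ).comp_tendsto hnorm
  rw [hasGradientAt_iff_isLittleO, ← Asymptotics.isLittleO_norm_right]
  simpa [Function.comp_def] using ho

theorem eq_of_isPreconnected_of_hasDerivAt_zero {g : ℝ → E} {s : Set ℝ} (hs : IsPreconnected s)
    (hg : ∀ t ∈ s, HasDerivAt g 0 t) {t u : ℝ} (ht : t ∈ s) (hu : u ∈ s) : g t = g u := by
  have hle := hs.ordConnected.convex.norm_image_sub_le_of_norm_hasDerivWithin_le (C := 0)
    (fun r hr => (hg r hr).hasDerivWithinAt) (by simp) hu ht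
  simpa [sub_eq_zero] using hle

end Calculus

section Radial

variable {n : ℕ} {δ : ℝ → ℝ}

-- At `x = 0` the right-hand side is `0` because `x = 0`, whatever the value of the quotient.
theorem gradient_radial (hδ : DifferentiableOn ℝ δ (Set.Ici 0))
    (hδ_zero : derivWithin δ (Set.Ici 0) 0 = 0) (x : Amb n) :
    gradient (radial δ) x = (deriv δ ‖x‖ / ‖x‖) • x := by
  rcases eq_or_ne x 0 with rfl | hx
  · have hδ0 := (hδ 0 Set.self_mem_Ici).hasDerivWithinAt
    rw [hδ_zero] at hδ0
    rw [smul_zero]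
    exact (hasGradientAt_comp_norm_zero hδ0).gradient
  · have hδx := hδ.differentiableAt (Ici_mem_nhds (norm_pos_iff.2 hx))
    exact (hasGradientAt_comp_norm hx hδx.hasDerivAt).gradient

theorem deriv_nonpos_of_antitoneOn_Ici {a t : ℝ} (hδ_anti : AntitoneOn δ (Set.Ici a))
    (ht : a < t) : deriv δ t ≤ 0 := by
  rw [← derivWithin_of_mem_nhds (Ici_mem_nhds ht)]
  exact hδ_anti.derivWithin_nonpos

theorem inner_gradient_radial_nonneg (hδ : DifferentiableOn ℝ δ (Set.Ici 0))
    (hδ_anti : AntitoneOn δ (Set.Ici 0)) (hδ_zero : derivWithin δ (Set.Ici 0) 0 = 0)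
    {x η : Amb n} (hx : ⟪x, η⟫_ℝ ≤ 0) : 0 ≤ ⟪gradient (radial δ) x, η⟫_ℝ := by
  rw [gradient_radial hδ hδ_zero, real_inner_smul_left]
  rcases eq_or_ne x 0 with rfl | hx0
  · simp
  · have hderiv := deriv_nonpos_of_antitoneOn_Ici hδ_anti (norm_pos_iff.2 hx0)
    exact mul_nonneg_of_nonpos_of_nonpos
      (div_nonpos_of_nonpos_of_nonneg hderiv (norm_nonneg x)) hx

theorem radial_eq_of_inner_gradient_eq_zero (hδ : DifferentiableOn ℝ δ (Set.Ici 0))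
    (hδ_zero : derivWithin δ (Set.Ici 0) 0 = 0) {S : Set (Amb n)} (hS : IsPreconnected S)
    {η : Amb n} {a : ℝ} (ha : a ≠ 0) (hSa : S ⊆ hyperplane η a)
    (hgrad : ∀ x ∈ S, ⟪gradient (radial δ) x, η⟫_ℝ = 0) {x y : Amb n} (hx : x ∈ S) (hy : y ∈ S) :
    radial δ x = radial δ y := by
  have hδ' : ∀ t ∈ norm '' S, HasDerivAt δ 0 t := by
    rintro _ ⟨z, hz, rfl⟩
    have hza : ⟪z, η⟫_ℝ = a := hSa hz
    have hz0 : z ≠ 0 := by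
      rintro rfl
      exact ha (by simpa using hza.symm)
    have hderiv : deriv δ ‖z‖ = 0 := by
      simpa [gradient_radial hδ hδ_zero, real_inner_smul_left, hza, ha, hz0] using hgrad z hz
    rw [← hderiv]
    exact (hδ.differentiableAt (Ici_mem_nhds (norm_pos_iff.2 hz0))).hasDerivAt
  exact eq_of_isPreconnected_of_hasDerivAt_zero (hS.image _ continuous_norm.continuousOn) hδ'
    (Set.mem_image_of_mem _ hx) (Set.mem_image_of_mem _ hy)

end Radial

section Surface

variable {n : ℕ} [NeZero n] {M : Type*} [TopologicalSpace M]
  [ChartedSpace (EuclideanHalfSpace n) M]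
  {F : Type*} [NormedAddCommGroup F] [NormedSpace ℝ F]
  {ψ : Amb n → ℝ} {f N X Y : M → Amb n} {p : M}

theorem dirDeriv_const (y : F) (p : M) (v : EuclideanSpace ℝ (Fin n)) :
    dirDeriv (fun _ : M => y) p v = 0 :=
  congr($(mvfderiv_const y) v)

theorem dirDeriv_sub {X Y : M → F} (hX : MDifferentiableAt (𝓡∂ n) 𝓘(ℝ, F) X p)
    (hY : MDifferentiableAt (𝓡∂ n) 𝓘(ℝ, F) Y p) (v : EuclideanSpace ℝ (Fin n)) :
    dirDeriv (X - Y) p v = dirDeriv X p v - dirDeriv Y p v :=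
  congr($(mvfderiv_sub hX hY) v)

theorem dirDeriv_smul {φ : M → ℝ} {X : M → F} (hφ : MDifferentiableAt (𝓡∂ n) 𝓘(ℝ, ℝ) φ p)
    (hX : MDifferentiableAt (𝓡∂ n) 𝓘(ℝ, F) X p) (v : EuclideanSpace ℝ (Fin n)) :
    dirDeriv (φ • X) p v = φ p • dirDeriv X p v + dirDeriv φ p v • X p :=
  congr($(mvfderiv_smul hφ hX) v)

/-- The height `p ↦ ⟨X p, η⟩` of a map `X` in the direction `η`. It is used for the immersion, whose
height is the function tested against parabolicity, and for its Gauss map. -/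
noncomputable def height (X : M → Amb n) (η : Amb n) (p : M) : ℝ := ⟪X p, η⟫_ℝ

theorem contMDiff_height {k : ℕ∞ω} (hX : ContMDiff (𝓡∂ n) 𝓘(ℝ, Amb n) k X) (η : Amb n) :
    ContMDiff (𝓡∂ n) 𝓘(ℝ, ℝ) k (height X η) :=
  ((innerSL ℝ η).contMDiff.comp hX).congr fun _ => real_inner_comm _ _

theorem mdifferentiableAt_height (hX : MDifferentiableAt (𝓡∂ n) 𝓘(ℝ, Amb n) X p) (η : Amb n) :
    MDifferentiableAt (𝓡∂ n) 𝓘(ℝ, ℝ) (height X η) p :=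
  ((innerSL ℝ η).mdifferentiableAt.comp p hX).congr_of_eventuallyEq
    (.of_forall fun _ => real_inner_comm _ _)

theorem dirDeriv_height (hX : MDifferentiableAt (𝓡∂ n) 𝓘(ℝ, Amb n) X p) (η : Amb n)
    (v : EuclideanSpace ℝ (Fin n)) :
    dirDeriv (height X η) p v = ⟪dirDeriv X p v, η⟫_ℝ := by
  have hheight : height X η = innerSL ℝ η ∘ X := funext fun _ => real_inner_comm _ _
  have hcomp := (((innerSL ℝ η).hasMFDerivAt (x := X p)).comp p hX.hasMFDerivAt).mfderiv
  rw [hheight, real_inner_comm]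
  exact congr($hcomp v)

theorem weightedDiv_const (ψ : Amb n → ℝ) (f : M → Amb n) (η : Amb n) (p : M) :
    weightedDiv ψ f (fun _ => η) p = ⟪gradient ψ (f p), η⟫_ℝ := by
  simp [weightedDiv, surfDiv, partialDeriv, dirDeriv_const]

theorem weightedDiv_sub (ψ : Amb n → ℝ) (f : M → Amb n)
    (hX : MDifferentiableAt (𝓡∂ n) 𝓘(ℝ, Amb n) X p)
    (hY : MDifferentiableAt (𝓡∂ n) 𝓘(ℝ, Amb n) Y p) :
    weightedDiv ψ f (X - Y) p = weightedDiv ψ f X p - weightedDiv ψ f Y p := by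
  simp only [weightedDiv, surfDiv, partialDeriv, dirDeriv_sub hX hY, Pi.sub_apply, inner_sub_left,
    inner_sub_right, mul_sub, Finset.sum_sub_distrib]
  ring

theorem gram_inv_symm (f : M → Amb n) (p : M) (i j : Fin n) :
    (gram f p)⁻¹ i j = (gram f p)⁻¹ j i :=
  (Matrix.isHermitian_gram ℝ (partialDeriv f p)).inv.apply j i

theorem surfDiv_smul (f : M → Amb n) {φ : M → ℝ} (hφ : MDifferentiableAt (𝓡∂ n) 𝓘(ℝ, ℝ) φ p)
    (hX : MDifferentiableAt (𝓡∂ n) 𝓘(ℝ, Amb n) X p) :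
    surfDiv f (φ • X) p = φ p * surfDiv f X p + ⟪surfGrad f φ p, X p⟫_ℝ := by
  have hgrad : ⟪surfGrad f φ p, X p⟫_ℝ =
      ∑ i, ∑ j, (gram f p)⁻¹ i j * (partialDeriv φ p i * ⟪X p, partialDeriv f p j⟫_ℝ) := by
    rw [Finset.sum_comm]
    simp only [surfGrad, sum_inner, real_inner_smul_left]
    refine Finset.sum_congr rfl fun i _ => Finset.sum_congr rfl fun j _ => ?_
    rw [gram_inv_symm f p i j, real_inner_comm, mul_assoc]
  rw [hgrad, surfDiv, surfDiv, Finset.mul_sum, ← Finset.sum_add_distrib]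
  refine Finset.sum_congr rfl fun i _ => ?_
  rw [Finset.mul_sum, ← Finset.sum_add_distrib]
  refine Finset.sum_congr rfl fun j _ => ?_
  simp only [partialDeriv, dirDeriv_smul hφ hX, inner_add_left, real_inner_smul_left]
  ring

theorem weightedDiv_smul (ψ : Amb n → ℝ) (f : M → Amb n) {φ : M → ℝ}
    (hφ : MDifferentiableAt (𝓡∂ n) 𝓘(ℝ, ℝ) φ p)
    (hX : MDifferentiableAt (𝓡∂ n) 𝓘(ℝ, Amb n) X p) :
    weightedDiv ψ f (φ • X) p = φ p * weightedDiv ψ f X p + ⟪surfGrad f φ p, X p⟫_ℝ := by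
  rw [weightedDiv, weightedDiv, surfDiv_smul f hφ hX, Pi.smul_apply', real_inner_smul_right]
  ring

/-- The tangent space of the hypersurface at `f p` as a linear subspace of `ℝⁿ⁺¹`, spanned by the
coordinate vectors of the preferred chart. -/
def tangentPlane (f : M → Amb n) (p : M) : Submodule ℝ (Amb n) :=
  Submodule.span ℝ (Set.range fun i : Fin n => partialDeriv f p i)

theorem surfGrad_mem_tangentPlane (f : M → Amb n) (u : M → ℝ) (p : M) :
    surfGrad f u p ∈ tangentPlane f p :=
  Submodule.sum_mem _ fun i _ => Submodule.sum_mem _ fun _ _ =>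
    Submodule.smul_mem _ _ (Submodule.subset_span ⟨i, rfl⟩)

theorem inner_eq_zero_of_mem_tangentPlane (hN : IsGaussMap f N) {w : Amb n}
    (hw : w ∈ tangentPlane f p) : ⟪w, N p⟫_ℝ = 0 := by
  have hle : tangentPlane f p ≤ (ℝ ∙ N p)ᗮ := by
    rw [tangentPlane, Submodule.span_le]
    rintro _ ⟨i, rfl⟩
    exact Submodule.mem_orthogonal_singleton_iff_inner_left.2 (hN.normal p _)
  exact Submodule.mem_orthogonal_singleton_iff_inner_left.1 (hle hw)

theorem linearIndependent_partialDeriv (hf : IsHypersurface f) (p : M) :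
    LinearIndependent ℝ fun i : Fin n => partialDeriv f p i := by
  let L : EuclideanSpace ℝ (Fin n) →ₗ[ℝ] Amb n := (mvfderiv (𝓡∂ n) f p).toLinearMap
  have hL : LinearMap.ker L = ⊥ := LinearMap.ker_eq_bot.2 (hf.injective_dirDeriv p)
  have hbasis : (fun i : Fin n => partialDeriv f p i) =
      L ∘ (EuclideanSpace.basisFun (Fin n) ℝ).toBasis := by
    funext i
    rw [Function.comp_apply, OrthonormalBasis.coe_toBasis, EuclideanSpace.basisFun_apply]
    rfl
  rw [hbasis]
  exact (EuclideanSpace.basisFun (Fin n) ℝ).toBasis.linearIndependent.map' L hL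

theorem tangentPlane_eq_orthogonal (hf : IsHypersurface f) (hN : IsGaussMap f N) (p : M) :
    tangentPlane f p = (ℝ ∙ N p)ᗮ := by
  have hN0 : N p ≠ 0 := norm_ne_zero_iff.1 (by simp [hN.norm_eq_one p])
  have : Fact (Module.finrank ℝ (Amb n) = n + 1) := ⟨by simp⟩
  refine Submodule.eq_of_le_of_finrank_eq (fun w hw => ?_) ?_
  · exact Submodule.mem_orthogonal_singleton_iff_inner_left.2
      (inner_eq_zero_of_mem_tangentPlane hN hw)
  · rw [Submodule.finrank_orthogonal_span_singleton (n := n) hN0, tangentPlane,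
      finrank_span_eq_card (linearIndependent_partialDeriv hf p), Fintype.card_fin]

theorem inner_surfGrad_partialDeriv (hf : IsHypersurface f) (u : M → ℝ) (p : M) (k : Fin n) :
    ⟪surfGrad f u p, partialDeriv f p k⟫_ℝ = partialDeriv u p k := by
  have hdet : (gram f p).det ≠ 0 :=
    Matrix.det_gram_ne_zero_iff_linearIndependent.2 (linearIndependent_partialDeriv hf p)
  have hinv : gram f p * (gram f p)⁻¹ = 1 := Matrix.mul_nonsing_inv _ hdet.isUnit
  calc ⟪surfGrad f u p, partialDeriv f p k⟫_ℝ
      = ∑ j, (gram f p * (gram f p)⁻¹) k j * partialDeriv u p j := by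
        simp only [surfGrad, sum_inner, real_inner_smul_left, Matrix.mul_apply, Finset.sum_mul]
        rw [Finset.sum_comm]
        refine Finset.sum_congr rfl fun j _ => Finset.sum_congr rfl fun i _ => ?_
        rw [gram, Matrix.of_apply, real_inner_comm]
        ring
    _ = partialDeriv u p k := by simp [hinv, Matrix.one_apply]

theorem surfGrad_height (hf : IsHypersurface f) (hN : IsGaussMap f N) (η : Amb n) (p : M) :
    surfGrad f (height f η) p = η - height N η p • N p := by
  have hfp : MDifferentiableAt (𝓡∂ n) 𝓘(ℝ, Amb n) f p := (hf.smooth p).mdifferentiableAt (by simp)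
  have hproj : (tangentPlane f p).starProjection η = surfGrad f (height f η) p := by
    have hle : tangentPlane f p ≤ (ℝ ∙ (η - surfGrad f (height f η) p))ᗮ := by
      rw [tangentPlane, Submodule.span_le]
      rintro _ ⟨i, rfl⟩
      rw [SetLike.mem_coe, Submodule.mem_orthogonal_singleton_iff_inner_right, inner_sub_left,
        inner_surfGrad_partialDeriv hf, real_inner_comm, sub_eq_zero]
      exact (dirDeriv_height hfp η _).symm
    exact Submodule.eq_starProjection_of_mem_of_inner_eq_zero (surfGrad_mem_tangentPlane f _ p)
      fun w hw => Submodule.mem_orthogonal_singleton_iff_inner_right.1 (hle hw)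
  rw [← hproj, tangentPlane_eq_orthogonal hf hN, Submodule.starProjection_orthogonal_val,
    Submodule.starProjection_unit_singleton ℝ (hN.norm_eq_one p)]
  rfl

theorem weightedLaplacian_height (hf : IsHypersurface f) (hN : IsGaussMap f N)
    (ψ : Amb n → ℝ) (η : Amb n) (p : M) :
    weightedLaplacian ψ f (height f η) p =
      ⟪gradient ψ (f p), η⟫_ℝ + height N η p * weightedMeanCurvature ψ f N p := by
  have hNp : MDifferentiableAt (𝓡∂ n) 𝓘(ℝ, Amb n) N p := (hN.smooth p).mdifferentiableAt (by simp)
  have hgrad : surfGrad f (height f η) = (fun _ => η) - height N η • N :=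
    funext (surfGrad_height hf hN η)
  have hnormal : ⟪surfGrad f (height N η) p, N p⟫_ℝ = 0 :=
    inner_eq_zero_of_mem_tangentPlane hN (surfGrad_mem_tangentPlane f _ p)
  have hheight := mdifferentiableAt_height hNp η
  rw [weightedLaplacian, hgrad, weightedDiv_sub ψ f mdifferentiableAt_const (hheight.smul hNp),
    weightedDiv_const, weightedDiv_smul ψ f hheight hNp, hnormal, weightedMeanCurvature]
  ring

theorem weightedLaplacian_const (ψ : Amb n → ℝ) (f : M → Amb n) (a : ℝ) (p : M) :
    weightedLaplacian ψ f (fun _ => a) p = 0 := by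
  have hgrad : surfGrad f (fun _ : M => a) = fun _ => 0 := by
    funext q
    simp [surfGrad, partialDeriv, dirDeriv_const]
  rw [weightedLaplacian, hgrad, weightedDiv_const, inner_zero_right]

theorem inner_surfGrad_height_of_isInnerConormal (hf : IsHypersurface f) (hN : IsGaussMap f N)
    (η : Amb n) {ν : Amb n} (hν : IsInnerConormal f p ν) :
    ⟪surfGrad f (height f η) p, ν⟫_ℝ = ⟪η, ν⟫_ℝ := by
  obtain ⟨-, ⟨v, -, rfl⟩, -⟩ := hν
  rw [surfGrad_height hf hN, inner_sub_left, real_inner_smul_left, real_inner_comm _ (N p),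
    hN.normal, mul_zero, sub_zero]

theorem exists_range_subset_hyperplane (hf : IsHypersurface f) (hN : IsGaussMap f N)
    (h_parabolic : IsWeightedParabolic ψ f) (h_minimal : IsWeightedMinimal ψ f N) {η : Amb n}
    (h_bdd : BddAbove (Set.range (height f η)))
    (h_grad : ∀ p ∈ (𝓡∂ n).interior M, 0 ≤ ⟪gradient ψ (f p), η⟫_ℝ)
    (h_bdry : ∀ p ∈ (𝓡∂ n).boundary M, ∀ ν : Amb n, IsInnerConormal f p ν → 0 ≤ ⟪η, ν⟫_ℝ) :
    ∃ a : ℝ, Set.range f ⊆ hyperplane η a := by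
  have hsmooth : ContMDiff (𝓡∂ n) 𝓘(ℝ, ℝ) 2 (height f η) :=
    contMDiff_height (hf.smooth.of_le (WithTop.coe_le_coe.2 le_top)) η
  obtain ⟨a, ha⟩ := h_parabolic (height f η) hsmooth h_bdd
    (fun p hp => by
      rw [weightedLaplacian_height hf hN, h_minimal p, mul_zero, add_zero]
      exact h_grad p hp)
    (fun p hp ν hν => by
      rw [inner_surfGrad_height_of_isInnerConormal hf hN η hν]
      exact h_bdry p hp ν hν)
  exact ⟨a, Set.range_subset_iff.2 ha⟩

theorem inner_gradient_eq_zero_of_range_subset_hyperplane (hf : IsHypersurface f)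
    (hN : IsGaussMap f N) (h_minimal : IsWeightedMinimal ψ f N) {η : Amb n} {a : ℝ}
    (ha : Set.range f ⊆ hyperplane η a) (p : M) : ⟪gradient ψ (f p), η⟫_ℝ = 0 := by
  have hheight : height f η = fun _ => a := funext (Set.range_subset_iff.1 ha)
  have hlap := weightedLaplacian_height hf hN ψ η p
  rwa [hheight, weightedLaplacian_const, h_minimal p, mul_zero, add_zero, eq_comm] at hlap

end Surface

end WeightedHypersurface

open WeightedHypersurface in
theorem proposition3p11_general {n : ℕ} [NeZero n]
    {δ : ℝ → ℝ} (hδ : DifferentiableOn ℝ δ (Set.Ici 0)) (hδ_anti : AntitoneOn δ (Set.Ici 0))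
    (hδ_zero : derivWithin δ (Set.Ici 0) 0 = 0)
    {M : Type*} [TopologicalSpace M] [PreconnectedSpace M]
    [ChartedSpace (EuclideanHalfSpace n) M]
    {f N : M → Amb n} (hf : IsHypersurface f) (hN : IsGaussMap f N)
    (h_parabolic : IsWeightedParabolic (radial δ) f)
    (h_minimal : IsWeightedMinimal (radial δ) f N)
    {η : Amb n} (h_sub : Set.range f ⊆ closedHalfSpace η 0)
    (h_bdry : ∀ p ∈ (𝓡∂ n).boundary M, ∀ ν : Amb n, IsInnerConormal f p ν → 0 ≤ ⟪η, ν⟫_ℝ) :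
    (∃ a : ℝ, Set.range f ⊆ hyperplane η a) ∧
    ((∃ p q : M, radial δ (f p) ≠ radial δ (f q)) → Set.range f ⊆ hyperplane η 0) := by
  have hle : ∀ p, height f η p ≤ 0 := Set.range_subset_iff.1 h_sub
  obtain ⟨a, ha⟩ := exists_range_subset_hyperplane hf hN h_parabolic h_minimal
    ⟨0, Set.forall_mem_range.2 hle⟩
    (fun p _ => inner_gradient_radial_nonneg hδ hδ_anti hδ_zero (hle p)) h_bdry
  refine ⟨⟨a, ha⟩, fun ⟨p, q, hpq⟩ => ?_⟩
  obtain rfl | ha0 := eq_or_ne a 0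
  · exact ha
  · have hgrad := inner_gradient_eq_zero_of_range_subset_hyperplane hf hN h_minimal ha
    exact absurd (radial_eq_of_inner_gradient_eq_zero hδ hδ_zero
      (isPreconnected_range hf.smooth.continuous) ha0 ha (Set.forall_mem_range.2 hgrad)
      (Set.mem_range_self p) (Set.mem_range_self q)) hpq

open WeightedHypersurface in
theorem proposition3p11 {n : ℕ} [NeZero n]
    -- the radial weight
    (δ : ℝ → ℝ) (hδ : ContDiffOn ℝ 1 δ (Set.Ici 0)) (hδ_anti : AntitoneOn δ (Set.Ici 0))
    (hδ_zero : derivWithin δ (Set.Ici 0) 0 = 0)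
    -- the two-sided connected hypersurface, possibly with boundary
    {M : Type*} [TopologicalSpace M] [T2Space M] [SecondCountableTopology M] [ConnectedSpace M]
    [ChartedSpace (EuclideanHalfSpace n) M] [IsManifold (𝓡∂ n) ∞ M]
    (f N : M → Amb n) (hf : IsHypersurface f) (hN : IsGaussMap f N)
    (h_parabolic : IsWeightedParabolic (radial δ) f)
    (h_minimal : IsWeightedMinimal (radial δ) f N)
    -- the half-space
    (η : Amb n) (hη : ‖η‖ = 1) (c : ℝ) (h_zero : (0 : Amb n) ∈ frontier (closedHalfSpace η c))
    (h_sub : Set.range f ⊆ closedHalfSpace η c)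
    (h_bdry : ∀ p ∈ (𝓡∂ n).boundary M, ∀ ν : Amb n, IsInnerConormal f p ν → 0 ≤ ⟪η, ν⟫_ℝ) :
    (∃ a : ℝ, Set.range f ⊆ hyperplane η a) ∧
    ((∃ p q : M, radial δ (f p) ≠ radial δ (f q)) →
      Set.range f ⊆ frontier (closedHalfSpace η c)) := by
  have h_frontier : frontier (closedHalfSpace η c) = hyperplane η c :=
    frontier_inner_le (norm_ne_zero_iff.1 (hη ▸ one_ne_zero)) c
  rw [h_frontier] at h_zero ⊢
  obtain rfl : 0 = c := (inner_zero_left η).symm.trans h_zero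
  exact proposition3p11_general (hδ.differentiableOn one_ne_zero) hδ_anti hδ_zero hf hN
    h_parabolic h_minimal h_sub h_bdry
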